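/- A \emph{graph} $\mathsf{G}$ consists of a set $\mathsf{V}$ of vertices, a set $\mathsf{D}$ of directed edges, source and target maps $s,t\colon\mathsf{D}\to\mathsf{V}$, and an involution $e\mapsto\overline{e}$ of $\mathsf{D}$ such that $\overline{e}\neq e$ and $s(\overline{e})=t(e)$ for all $e\in\mathsf{D}$ (loops and multiple edges are allowed; $\mathsf{G}$ need not be simple). It is \emph{finite} if $\mathsf{V}$ and $\mathsf{D}$ are finite, and \emph{connected} if any two vertices are joined by a path. A \emph{covering map} $p\colon\widetilde{\mathsf{G}}\to\mathsf{G}$ consists of two maps $\widetilde{\mathsf{V}}\to\mathsf{V}$ and $\widetilde{\mathsf{D}}\to\mathsf{D}$, both denoted by $p$, that commute with sources, targets and inversion, such that $p\colon\widetilde{\mathsf{V}}\to\mathsf{V}$ is surjective and, for every $\tilde v\in\widetilde{\mathsf{V}}$, $p$ restricts to bijections $\{\tilde e: s(\tilde e)=\tilde v\}\to\{e: s(e)=p(\tilde v)\}$ and $\{\tilde e: t(\tilde e)=\tilde v\}\to\{e: t(e)=p(\tilde v)\}$; in that case $\widetilde{\mathsf{G}}$ is called a \emph{covering graph} of $\mathsf{G}$.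 A \emph{circuit} is a closed path $(e_1,\dots,e_n)$, $n\ge 1$, with $e_{i+1}\neq\overline{e_i}$ for $1\le i<n$, $e_1\neq\overline{e_n}$, and $t(e_1),\dots,t(e_n)$ all distinct. A \emph{spanning forest} of $\mathsf{G}$ is a subgraph without circuit that contains all vertices of $\mathsf{G}$; a \emph{spanning tree} is a non-empty connected spanning forest. A \emph{rooted spanning forest} is a spanning forest together with the choice of one vertex (the root) in each of its connected components. Let $\mathsf{G}$ be a finite connected graph and let $\widetilde{\mathsf{G}}$ be a finite (not necessarily connected) covering graph of $\mathsf{G}$. Then: (i) the number of spanning trees of $\mathsf{G}$ divides the number of spanning trees of $\widetilde{\mathsf{G}}$; (ii) the number of rooted spanning forests of $\mathsf{G}$ divides the number of rooted spanning forests of $\widetilde{\mathsf{G}}$. -/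

import Mathlib

universe u v u' v'

/-- A graph in the sense of Serre, with vertex set `V` and set of directed edges `D`: source and
target maps together with a fixed-point free involution `e ↦ inv e` exchanging source and target.
Loops and multiple edges are allowed; an unoriented edge is a pair `{e, inv e}`. -/
@[ext]
structure SerreGraph (V : Type u) (D : Type v) where
  s : D → V
  t : D → V
  inv : D → D
  inv_inv : ∀ e, inv (inv e) = e
  inv_ne : ∀ e, inv e ≠ e
  s_inv : ∀ e, s (inv e) = t e

namespace SerreGraph

variable {V : Type u} {D : Type v} {V' : Type u'} {D' : Type v'}

/-- `Γ.IsPath v [e₁, …, eₙ] w`: the edges `e₁, …, eₙ` form a path from `v` to `w`, that is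
`s e₁ = v`, `t eᵢ = s eᵢ₊₁` and `t eₙ = w`; the empty list is the constant path, with `v = w`. -/
def IsPath (Γ : SerreGraph V D) : V → List D → V → Prop
  | v, [], w => v = w
  | v, e :: l, w => Γ.s e = v ∧ Γ.IsPath (Γ.t e) l w

/-- Any two vertices are joined by a path. -/
def Connected (Γ : SerreGraph V D) : Prop :=
  ∀ v w : V, ∃ l : List D, Γ.IsPath v l w

/-- `e 0, …, e n` is a circuit (of length `n + 1`). Here `i + 1` is taken cyclically in
`Fin (n + 1)`, so that the first two conditions also say that the path closes up,
`t (e n) = s (e 0)`, and that `e 0 ≠ inv (e n)`. -/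
structure IsCircuit (Γ : SerreGraph V D) (n : ℕ) (e : Fin (n + 1) → D) : Prop where
  link : ∀ i, Γ.t (e i) = Γ.s (e (i + 1))
  reduced : ∀ i, e (i + 1) ≠ Γ.inv (e i)
  distinct : Function.Injective fun i => Γ.t (e i)

/-- A subgraph: a set of vertices and a set of directed edges, closed under source (hence also
under target) and under inversion. -/
@[ext]
structure Subgraph (Γ : SerreGraph V D) where
  verts : Set V
  edges : Set D
  s_mem : ∀ e ∈ edges, Γ.s e ∈ verts
  inv_mem : ∀ e ∈ edges, Γ.inv e ∈ edges

namespace Subgraph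

variable {Γ : SerreGraph V D}

/-- There is a path from `v` to `w` all of whose edges lie in the subgraph. -/
def Joined (T : Γ.Subgraph) (v w : V) : Prop :=
  ∃ l : List D, (∀ e ∈ l, e ∈ T.edges) ∧ Γ.IsPath v l w

/-- The subgraph contains no circuit. -/
def Acyclic (T : Γ.Subgraph) : Prop :=
  ∀ (n : ℕ) (e : Fin (n + 1) → D), (∀ i, e i ∈ T.edges) → ¬ Γ.IsCircuit n e

/-- A spanning forest: a subgraph without circuit that contains all the vertices. -/
structure IsSpanningForest (F : Γ.Subgraph) : Prop where
  spanning : F.verts = Set.univ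
  acyclic : F.Acyclic

/-- A spanning tree: a connected non-empty subgraph without circuit that contains all the
vertices. -/
structure IsSpanningTree (T : Γ.Subgraph) : Prop where
  nonempty : T.verts.Nonempty
  connected : ∀ v ∈ T.verts, ∀ w ∈ T.verts, T.Joined v w
  acyclic : T.Acyclic
  spanning : T.verts = Set.univ

/-- `R` is a set of roots of the subgraph `F`: a set of vertices of `F` that contains exactly one
vertex of each connected component of `F`. -/
structure IsRootSet (F : Γ.Subgraph) (R : Set V) : Prop where
  subset : R ⊆ F.verts
  existsUnique_root : ∀ v ∈ F.verts, ∃! r, r ∈ R ∧ F.Joined v r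

end Subgraph

/-- The number of spanning trees of a (finite) graph. -/
noncomputable def numSpanningTrees (Γ : SerreGraph V D) : ℕ :=
  Nat.card {T : Γ.Subgraph // T.IsSpanningTree}

/-- The number of rooted spanning forests of a (finite) graph, i.e. of pairs consisting of a
spanning forest and of the choice of a root in each of its connected components. -/
noncomputable def numRootedSpanningForests (Γ : SerreGraph V D) : ℕ :=
  Nat.card {P : Γ.Subgraph × Set V // P.1.IsSpanningForest ∧ P.1.IsRootSet P.2}

/-- A morphism of graphs. -/
structure Hom (Γ' : SerreGraph V' D') (Γ : SerreGraph V D) where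
  onVerts : V' → V
  onEdges : D' → D
  s_comm : ∀ e, Γ.s (onEdges e) = onVerts (Γ'.s e)
  t_comm : ∀ e, Γ.t (onEdges e) = onVerts (Γ'.t e)
  inv_comm : ∀ e, onEdges (Γ'.inv e) = Γ.inv (onEdges e)

/-- A covering map of graphs: a morphism that is surjective on vertices and restricts, for every
vertex `v` upstairs, to a bijection from the edges with source (resp. target) `v` onto the edges
with source (resp. target) the image of `v`. -/
structure Hom.IsCovering {Γ' : SerreGraph V' D'} {Γ : SerreGraph V D} (p : Γ'.Hom Γ) : Prop where
  surjective : Function.Surjective p.onVerts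
  bijOn_source : ∀ v, Set.BijOn p.onEdges {e | Γ'.s e = v} {e | Γ.s e = p.onVerts v}
  bijOn_target : ∀ v, Set.BijOn p.onEdges {e | Γ'.t e = v} {e | Γ.t e = p.onVerts v}

end SerreGraph

/-!
Both numbers are orders of cokernels of integral matrices, and a covering induces surjections
between these cokernels (an infinite cokernel corresponding to the number `0`).

Fix a set `S` of vertices, and let `L_S` be the Laplacian plus the diagonal matrix of the indicator
function of `S`. The matrix-tree theorem in the form used here (`det_laplacian`) says that `det L_S`
is the number of spanning forests with a root in each component, all roots lying in `S`. For `S` the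
set of all vertices these are the rooted spanning forests; for `S = {v}` they are the spanning trees.

For the proof of the matrix-tree theorem, the row of `L_S` at `v` is a sum of terms, one for each
edge going out of `v` and one more if `v ∈ S`. As the determinant is multilinear in the rows, it is
the sum, over the functions `f` that choose one of these terms at every vertex, of the determinants
of simpler matrices. Such a determinant is `1` if following the chosen edges always ends at a vertex
where the extra term was chosen (the matrix is then triangular), and `0` if it can go round a cycle.
The functions `f` of the first kind are the parent functions of the rooted forests
(`numForestsRootedIn_eq_card`), each rooted forest having exactly one. That a forest has no other
edges than those between a vertex and its parent follows from `Subgraph.Acyclic.eq_nil`: a forest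
has no closed path without backtracking.

The index in `ℤ^V` of the lattice spanned by the rows of `L_S` is `det L_S`
(`index_range_vecMulLinear`). The push-forward `ℤ^V' → ℤ^V` along a covering is surjective and
commutes with the Laplacians, as a covering is bijective on the edges going out of a vertex. It
therefore maps the row lattice upstairs into the one downstairs, in the case of one root because
`δ_v`, the sum of all the rows of `L_{v}`, is in that lattice. So the index downstairs divides the
index upstairs.
-/

namespace SerreGraph

/-! ### Paths and circuits -/

section Paths

variable {V : Type u} {D : Type v} {Γ : SerreGraph V D}

theorem t_inv (Γ : SerreGraph V D) (e : D) : Γ.t (Γ.inv e) = Γ.s e := by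
  rw [← Γ.s_inv, Γ.inv_inv]

theorem IsPath.append {u v w : V} {l l' : List D} (h : Γ.IsPath u l v) (h' : Γ.IsPath v l' w) :
    Γ.IsPath u (l ++ l') w := by
  induction l generalizing u with
  | nil => cases h; exact h'
  | cons e l ih => exact ⟨h.1, ih h.2⟩

theorem IsPath.reverse {u v : V} {l : List D} (h : Γ.IsPath u l v) :
    Γ.IsPath v (l.map Γ.inv).reverse u := by
  induction l generalizing u with
  | nil => exact Eq.symm h
  | cons e l ih =>
    rw [List.map_cons, List.reverse_cons]
    exact (ih h.2).append ⟨Γ.s_inv e, (Γ.t_inv e).trans h.1⟩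

namespace Subgraph

variable {F : Γ.Subgraph}

theorem Joined.trans {u v w : V} (h : F.Joined u v) (h' : F.Joined v w) : F.Joined u w := by
  obtain ⟨l, hl, h⟩ := h
  obtain ⟨l', hl', h'⟩ := h'
  refine ⟨l ++ l', fun e he => ?_, h.append h'⟩
  exact (List.mem_append.1 he).elim (hl e) (hl' e)

theorem Joined.symm {u v : V} (h : F.Joined u v) : F.Joined v u := by
  obtain ⟨l, hl, h⟩ := h
  refine ⟨_, fun e he => ?_, h.reverse⟩
  obtain ⟨e', he', rfl⟩ := List.mem_map.1 (List.mem_reverse.1 he)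
  exact F.inv_mem _ (hl _ he')

theorem Joined.of_mem {e : D} (he : e ∈ F.edges) : F.Joined (Γ.s e) (Γ.t e) :=
  ⟨[e], by simpa using he, rfl, rfl⟩

end Subgraph

/-- A list of edges without backtracking: no edge is followed by its inverse. -/
def IsReduced (Γ : SerreGraph V D) (l : List D) : Prop :=
  l.IsChain fun a b => b ≠ Γ.inv a

theorem IsReduced.reverse {l : List D} (h : Γ.IsReduced l) :
    Γ.IsReduced (l.map Γ.inv).reverse := by
  unfold IsReduced at *
  rw [List.isChain_reverse, List.isChain_map]
  refine h.imp fun a b hab hba => hab ?_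
  rw [hba, Γ.inv_inv]

/-- A non-empty reduced path, as a sequence of edges indexed by `0, …, n`. -/
theorem IsPath.exists_seq {u v : V} {l : List D} (h : Γ.IsPath u l v) (hr : Γ.IsReduced l)
    (hl : l ≠ []) :
    ∃ (n : ℕ) (w : ℕ → D), (∀ i < n, Γ.t (w i) = Γ.s (w (i + 1)) ∧ w (i + 1) ≠ Γ.inv (w i)) ∧
      l.head? = some (w 0) ∧ Γ.s (w 0) = u ∧ Γ.t (w n) = v ∧ ∀ i ≤ n, w i ∈ l := by
  induction l generalizing u with
  | nil => exact absurd rfl hl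
  | cons e l ih =>
    by_cases hl' : l = []
    · subst hl'
      exact ⟨0, fun _ => e, by simp, rfl, h.1, h.2, by simp⟩
    · obtain ⟨n, w, h1, h2, h3, h4, h5⟩ := ih h.2 (List.IsChain.tail hr) hl'
      refine ⟨n + 1, fun i => Nat.casesOn i e w, ?_, rfl, h.1, h4, ?_⟩
      · rintro (_ | i) hi
        · exact ⟨h3.symm, (List.isChain_cons.1 hr).1 _ h2⟩
        · exact h1 i (by omega)
      · rintro (_ | i) hi
        · exact List.mem_cons_self
        · exact List.mem_cons_of_mem _ (h5 i (by omega))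

/-- A closed reduced path of minimal length among those with edges in `F` is a circuit: a repeated
vertex, or a cancellation between the last and the first edge, would give a shorter one. -/
theorem Subgraph.Acyclic.eq_nil {F : Γ.Subgraph} (hF : F.Acyclic) {v : V} {l : List D}
    (h : Γ.IsPath v l v) (hr : Γ.IsReduced l) (hl : ∀ e ∈ l, e ∈ F.edges) : l = [] := by
  classical
  by_contra hne
  let P : ℕ → Prop := fun n => ∃ w : ℕ → D,
    (∀ i < n, Γ.t (w i) = Γ.s (w (i + 1)) ∧ w (i + 1) ≠ Γ.inv (w i)) ∧
      Γ.t (w n) = Γ.s (w 0) ∧ ∀ i ≤ n, w i ∈ F.edges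
  have hex : ∃ n, P n := by
    obtain ⟨n, w, h1, -, h3, h4, h5⟩ := h.exists_seq hr hne
    exact ⟨n, w, h1, h4.trans h3.symm, fun i hi => hl _ (h5 i hi)⟩
  obtain ⟨n, ⟨w, hw, hclosed, hmem⟩, hmin⟩ : ∃ n, P n ∧ ∀ m < n, ¬ P m :=
    ⟨Nat.find hex, Nat.find_spec hex, fun m hm => Nat.find_min hex hm⟩
  have hends : w 0 ≠ Γ.inv (w n) := by
    intro h0
    rcases n with _ | _ | n
    · exact Γ.inv_ne _ h0.symm
    · exact (hw 0 (by omega)).2 (by rw [h0, Γ.inv_inv])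
    · refine hmin n (by omega) ⟨fun i => w (i + 1), fun i hi => hw (i + 1) (by omega), ?_,
        fun i hi => hmem _ (by omega)⟩
      rw [(hw (n + 1) (by omega)).1, ← Γ.t_inv, ← h0, (hw 0 (by omega)).1]
  have hinj : ∀ i j, i < j → j ≤ n → Γ.t (w i) ≠ Γ.t (w j) := by
    intro i j hij hj heq
    obtain ⟨k, rfl⟩ := Nat.exists_eq_add_of_lt hij
    refine hmin k (by omega) ⟨fun m => w (i + 1 + m), fun m hm => hw (i + 1 + m) (by omega), ?_,
      fun m hm => hmem _ (by omega)⟩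
    change Γ.t (w (i + 1 + k)) = Γ.s (w (i + 1))
    rw [show i + 1 + k = i + k + 1 by omega, ← heq]
    exact (hw i (by omega)).1
  have hstep : ∀ i : Fin (n + 1),
      Γ.t (w i) = Γ.s (w (i + 1 : Fin (n + 1))) ∧ w (i + 1 : Fin (n + 1)) ≠ Γ.inv (w i) := by
    intro i
    induction i using Fin.lastCases with
    | last => simpa using ⟨hclosed, hends⟩
    | cast i => simpa using hw i i.2
  refine hF n (fun i => w i) (fun i => hmem i (by omega))
    ⟨fun i => (hstep i).1, fun i => (hstep i).2, fun i j hij => ?_⟩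
  rcases lt_trichotomy i j with hlt | heq | hlt
  · exact absurd hij (hinj i j hlt (by omega))
  · exact heq
  · exact absurd hij.symm (hinj j i hlt (by omega))

end Paths

/-! ### Rooted forests and their parent functions -/

section Pointers

variable {V : Type u} {D : Type v} {Γ : SerreGraph V D}

/-- `Γ.Next f a b`: the function `f` sends `b` to an edge with target `a`. -/
def Next (Γ : SerreGraph V D) (f : V → Option D) (a b : V) : Prop :=
  ∃ e, f b = some e ∧ Γ.t e = a

/-- A rooted forest encoded by its parent function: `f v` is an edge going out of `v`, the first
one on the way from `v` to its root, and `f v = none` if `v` is a root. Well-foundedness says that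
following the edges never goes round a cycle (for finite `V`, that it always ends at a root). -/
structure IsParentFunction (Γ : SerreGraph V D) (f : V → Option D) : Prop where
  source : ∀ v e, f v = some e → Γ.s e = v
  wf : WellFounded (Γ.Next f)

/-- The subgraph with all the vertices whose edges are the values of `f` and their inverses. -/
def forestOf (Γ : SerreGraph V D) (f : V → Option D) : Γ.Subgraph where
  verts := Set.univ
  edges := {e | f (Γ.s e) = some e ∨ f (Γ.t e) = some (Γ.inv e)}
  s_mem _ _ := Set.mem_univ _
  inv_mem e he := by
    rcases he with he | he
    · exact Or.inr (by rw [Γ.t_inv, Γ.inv_inv, he])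
    · exact Or.inl (by rw [Γ.s_inv, he])

/-- A path of the forest from `v` to a root may wander, but following the parent edges from `v`
leads to the same root. -/
theorem IsPath.reflTransGen_next {f : V → Option D} {v r : V} {l : List D}
    (hl : Γ.IsPath v l r) (hmem : ∀ e ∈ l, e ∈ (Γ.forestOf f).edges) (hr : f r = none) :
    Relation.ReflTransGen (Function.swap (Γ.Next f)) v r := by
  induction l generalizing v with
  | nil => cases hl; exact .refl
  | cons e l ih =>
    have ht := ih hl.2 fun e' he' => hmem e' (List.mem_cons_of_mem _ he')
    obtain ⟨rfl, -⟩ := hl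
    rcases hmem e List.mem_cons_self with he | he
    · exact .head ⟨e, he, rfl⟩ ht
    · rcases ht.cases_head with heq | ⟨c, ⟨e', he', rfl⟩, hc⟩
      · rw [heq, hr] at he
        cases he
      · obtain rfl : Γ.inv e = e' := Option.some_inj.1 (he.symm.trans he')
        rwa [Γ.t_inv] at hc

namespace IsParentFunction

variable {f : V → Option D}

theorem mem_edges (hf : Γ.IsParentFunction f) {v : V} {e : D} (he : f v = some e) :
    e ∈ (Γ.forestOf f).edges :=
  Or.inl (by rw [hf.source v e he, he])

/-- The depth of a vertex below its root, as the rank of a well-founded relation. -/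
noncomputable def rank (hf : Γ.IsParentFunction f) (v : V) : Ordinal :=
  haveI : IsWellFounded V (Γ.Next f) := ⟨hf.wf⟩
  IsWellFounded.rank (Γ.Next f) v

theorem rank_lt (hf : Γ.IsParentFunction f) {v : V} {e : D} (he : f v = some e) :
    hf.rank (Γ.t e) < hf.rank v :=
  haveI : IsWellFounded V (Γ.Next f) := ⟨hf.wf⟩
  IsWellFounded.rank_lt_of_rel (r := Γ.Next f) ⟨e, he, rfl⟩

/-- At a vertex of a circuit where the rank is maximal, both the incoming edge reversed and the
outgoing edge would be the parent edge of that vertex. -/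
theorem acyclic (hf : Γ.IsParentFunction f) : (Γ.forestOf f).Acyclic := by
  intro n e he hc
  obtain ⟨i, hi⟩ := Finite.exists_max fun i => hf.rank (Γ.t (e i))
  have hin : f (Γ.t (e i)) = some (Γ.inv (e i)) := by
    refine (he i).resolve_left fun h => ?_
    have h1 := hf.rank_lt h
    have h2 := hi (i - 1)
    simp only [hc.link (i - 1), sub_add_cancel] at h2
    exact (h1.trans_le h2).false
  have hout : f (Γ.s (e (i + 1))) = some (e (i + 1)) := by
    refine (he (i + 1)).resolve_right fun h => ?_
    have h1 := hf.rank_lt h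
    rw [Γ.t_inv, ← hc.link i] at h1
    exact (h1.trans_le (hi (i + 1))).false
  rw [← hc.link i, hin, Option.some_inj] at hout
  exact hc.reduced i hout.symm

theorem isSpanningForest (hf : Γ.IsParentFunction f) : (Γ.forestOf f).IsSpanningForest :=
  ⟨rfl, hf.acyclic⟩

/-- Following the parent edges from a vertex gives a reduced path to a root. -/
theorem exists_path (hf : Γ.IsParentFunction f) (v : V) :
    ∃ r l, Γ.IsPath v l r ∧ f r = none ∧ Γ.IsReduced l ∧ ∀ e ∈ l, f (Γ.s e) = some e := by
  induction v using hf.wf.induction with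
  | _ v ih =>
    cases hv : f v with
    | none => exact ⟨v, [], rfl, hv, List.isChain_nil, by simp⟩
    | some e =>
      obtain ⟨r, l, hl, hr, hred, hmem⟩ := ih (Γ.t e) ⟨e, hv, rfl⟩
      have hs := hf.source v e hv
      refine ⟨r, e :: l, ⟨hs, hl⟩, hr, List.isChain_cons.2 ⟨fun e' he' heq => ?_, hred⟩, ?_⟩
      · have h1 := hf.rank_lt hv
        have h2 := hf.rank_lt (hmem e' (List.mem_of_mem_head? he'))
        subst heq
        rw [Γ.s_inv, Γ.t_inv, hs] at h2
        exact lt_asymm h1 h2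
      · rintro e' he'
        rcases List.mem_cons.1 he' with rfl | he'
        · rw [hs, hv]
        · exact hmem e' he'

theorem isRootSet (hf : Γ.IsParentFunction f) : (Γ.forestOf f).IsRootSet {v | f v = none} := by
  refine ⟨Set.subset_univ _, fun v _ => ?_⟩
  obtain ⟨r, l, hl, hr, -, hmem⟩ := hf.exists_path v
  have hj : (Γ.forestOf f).Joined v r := ⟨l, fun e he => Or.inl (hmem e he), hl⟩
  refine ⟨r, ⟨hr, hj⟩, fun r' hr' => ?_⟩
  obtain ⟨l', hmem', hl'⟩ := hr'.2.symm.trans hj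
  rcases (hl'.reflTransGen_next hmem' hr).cases_head with heq | ⟨_, ⟨e, he, -⟩, -⟩
  · exact heq
  · have := hr'.1
    simp only [Set.mem_ofPred_eq] at this
    rw [this] at he
    cases he

/-- A rooted forest has only one parent function. Where two of them differ, the parent of the
vertex for one is its child for the other, and they differ at that vertex too, so that there is no
vertex of maximal rank where they differ. -/
theorem eq_of_forestOf_eq [Finite V] {g : V → Option D} (hf : Γ.IsParentFunction f)
    (hg : Γ.IsParentFunction g) (hF : Γ.forestOf f = Γ.forestOf g)
    (hR : ∀ v, f v = none ↔ g v = none) : f = g := by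
  by_contra hne
  obtain ⟨v, hv, hmax⟩ := Set.exists_max_image {v | f v ≠ g v} hf.rank (Set.toFinite _)
    (Function.ne_iff.1 hne)
  rw [Set.mem_ofPred_eq] at hv
  cases hgv : g v with
  | none => exact hv (((hR v).2 hgv).trans hgv.symm)
  | some e =>
    have hs := hg.source v e hgv
    have he : e ∈ (Γ.forestOf f).edges := hF ▸ hg.mem_edges hgv
    have hft : f (Γ.t e) = some (Γ.inv e) := by
      refine he.resolve_left fun h => hv ?_
      rw [← hs, h, hs, hgv]
    have hgt : g (Γ.t e) ≠ some (Γ.inv e) := by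
      intro h
      have h1 := hg.rank_lt h
      rw [Γ.t_inv, hs] at h1
      exact lt_asymm h1 (hg.rank_lt hgv)
    have h1 := hf.rank_lt hft
    rw [Γ.t_inv, hs] at h1
    exact (h1.trans_le (hmax (Γ.t e) fun h => hgt (h.symm.trans hft))).false

end IsParentFunction

/-- Every rooted spanning forest has a parent function: send a vertex to the first edge of a
shortest path to a root. An edge `e` of the forest missed by it would close up the paths from its
ends to their common root to a closed reduced path. -/
theorem Subgraph.IsSpanningForest.exists_parentFunction {F : Γ.Subgraph}
    (hF : F.IsSpanningForest) {R : Set V} (hR : F.IsRootSet R) :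
    ∃ f, Γ.IsParentFunction f ∧ Γ.forestOf f = F ∧ {v | f v = none} = R := by
  classical
  have hex : ∀ v, ∃ n l r, l.length = n ∧ (∀ e ∈ l, e ∈ F.edges) ∧ r ∈ R ∧ Γ.IsPath v l r := by
    intro v
    obtain ⟨r, ⟨hr, l, hl, hp⟩, -⟩ := hR.existsUnique_root v (hF.spanning ▸ Set.mem_univ v)
    exact ⟨l.length, l, r, rfl, hl, hr, hp⟩
  -- the distance to the root
  let h : V → ℕ := fun v => Nat.find (hex v)
  have hstep : ∀ v, v ∉ R → ∃ e ∈ F.edges, Γ.s e = v ∧ h (Γ.t e) < h v := by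
    intro v hv
    obtain ⟨l, r, hlen, hl, hr, hp⟩ := Nat.find_spec (hex v)
    cases l with
    | nil => cases hp; exact absurd hr hv
    | cons e l =>
      refine ⟨e, hl e List.mem_cons_self, hp.1, lt_of_le_of_lt (b := l.length) ?_ ?_⟩
      · exact Nat.find_min' (hex _) ⟨l, r, rfl, fun e' he' => hl e' (List.mem_cons_of_mem _ he'),
          hr, hp.2⟩
      · exact Nat.lt_of_succ_le hlen.le
  choose p hpF hps hpt using hstep
  let f : V → Option D := fun v => if hv : v ∈ R then none else some (p v hv)
  have hnone : ∀ v, f v = none ↔ v ∈ R := by simp [f]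
  have hsome : ∀ v e, f v = some e → e ∈ F.edges ∧ Γ.s e = v ∧ h (Γ.t e) < h v := by
    intro v e hve
    by_cases hv : v ∈ R
    · simp [f, hv] at hve
    · obtain rfl : p v hv = e := by simpa [f, hv] using hve
      exact ⟨hpF v hv, hps v hv, hpt v hv⟩
  have hf : Γ.IsParentFunction f := by
    refine ⟨fun v e he => (hsome v e he).2.1, Subrelation.wf ?_ (measure h).wf⟩
    rintro a b ⟨e, he, rfl⟩
    exact (hsome b e he).2.2
  have hle : ∀ e, e ∈ (Γ.forestOf f).edges → e ∈ F.edges := by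
    rintro e (he | he)
    · exact (hsome _ _ he).1
    · exact Γ.inv_inv e ▸ F.inv_mem _ (hsome _ _ he).1
  refine ⟨f, hf, Subgraph.ext hF.spanning.symm (Set.Subset.antisymm hle fun e he => ?_),
    Set.ext hnone⟩
  by_contra hef
  change ¬ (_ ∨ _) at hef
  rw [not_or] at hef
  obtain ⟨r, l, hl, hr, hred, hmem⟩ := hf.exists_path (Γ.s e)
  obtain ⟨r', l', hl', hr', hred', hmem'⟩ := hf.exists_path (Γ.t e)
  have hlF : ∀ e' ∈ l, e' ∈ F.edges := fun e' he' => hle _ (Or.inl (hmem e' he'))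
  have hlF' : ∀ e' ∈ l', e' ∈ F.edges := fun e' he' => hle _ (Or.inl (hmem' e' he'))
  obtain rfl : r = r' :=
    (hR.existsUnique_root (Γ.s e) (hF.spanning ▸ Set.mem_univ _)).unique
      ⟨(hnone r).1 hr, l, hlF, hl⟩
      ⟨(hnone r').1 hr', (Subgraph.Joined.of_mem he).trans ⟨l', hlF', hl'⟩⟩
  -- the way from the root up to `Γ.s e`, along `e`, and from `Γ.t e` down to the root
  have hnil := hF.acyclic.eq_nil (l := (l.map Γ.inv).reverse ++ e :: l')
    (hl.reverse.append ⟨rfl, hl'⟩) (List.isChain_append.2 ⟨hred.reverse, ?_, ?_⟩) ?_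
  · simp at hnil
  · refine List.isChain_cons.2 ⟨fun e' he' heq => hef.2 ?_, hred'⟩
    cases l' with
    | nil => cases he'
    | cons a l' =>
      obtain rfl : a = e' := by simpa using he'
      rw [← heq, ← hl'.1, hmem' a List.mem_cons_self]
  · intro x hx y hy heq
    obtain rfl : e = y := by simpa using hy
    cases l with
    | nil => simp at hx
    | cons a l =>
      obtain rfl : Γ.inv a = x := by simpa using hx
      rw [Γ.inv_inv] at heq
      subst heq
      exact hef.1 (hmem e List.mem_cons_self)
  · intro e' he'
    rcases List.mem_append.1 he' with he' | he'
    · obtain ⟨e'', he'', rfl⟩ := List.mem_map.1 (List.mem_reverse.1 he')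
      exact F.inv_mem _ (hlF _ he'')
    · rcases List.mem_cons.1 he' with rfl | he'
      · exact he
      · exact hlF' _ he'

/-- The number of spanning forests with a root in each component, all roots being in `S`. -/
noncomputable def numForestsRootedIn (Γ : SerreGraph V D) (S : Set V) : ℕ :=
  Nat.card {P : Γ.Subgraph × Set V // (P.1.IsSpanningForest ∧ P.1.IsRootSet P.2) ∧ P.2 ⊆ S}

theorem numForestsRootedIn_univ (Γ : SerreGraph V D) :
    Γ.numForestsRootedIn Set.univ = Γ.numRootedSpanningForests := by
  simp [numForestsRootedIn, numRootedSpanningForests]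

theorem numForestsRootedIn_singleton (Γ : SerreGraph V D) (v : V) :
    Γ.numForestsRootedIn {v} = Γ.numSpanningTrees := by
  -- as every component has a root, there is only one component if all roots are equal to `v`
  have key : ∀ (F : Γ.Subgraph) (R : Set V), F.IsSpanningForest → F.IsRootSet R → R ⊆ {v} →
      R = {v} ∧ F.IsSpanningTree := by
    intro F R hF hR hsub
    have hj : ∀ w, v ∈ R ∧ F.Joined w v := by
      intro w
      obtain ⟨r, ⟨hr, hw⟩, -⟩ := hR.existsUnique_root w (hF.spanning ▸ Set.mem_univ w)
      obtain rfl : r = v := hsub hr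
      exact ⟨hr, hw⟩
    exact ⟨Set.Subset.antisymm hsub (Set.singleton_subset_iff.2 (hj v).1),
      ⟨v, hF.spanning ▸ Set.mem_univ v⟩, fun a _ b _ => (hj a).2.trans (hj b).2.symm,
      hF.acyclic, hF.spanning⟩
  refine Nat.card_congr
    ⟨fun P => ⟨P.1.1, (key _ _ P.2.1.1 P.2.1.2 P.2.2).2⟩,
      fun T => ⟨(T.1, {v}), ⟨⟨T.2.spanning, T.2.acyclic⟩, ?_, ?_⟩, subset_rfl⟩, fun P => ?_,
      fun T => rfl⟩
  · rw [T.2.spanning]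
    exact Set.subset_univ _
  · intro w hw
    exact ⟨v, ⟨rfl, T.2.connected w hw v (T.2.spanning ▸ Set.mem_univ v)⟩, fun r hr => hr.1⟩
  · exact Subtype.ext (Prod.ext rfl (key _ _ P.2.1.1 P.2.1.2 P.2.2).1.symm)

theorem numForestsRootedIn_eq_card [Finite V] (Γ : SerreGraph V D) (S : Set V) :
    Γ.numForestsRootedIn S =
      Nat.card {f : V → Option D // Γ.IsParentFunction f ∧ {v | f v = none} ⊆ S} := by
  symm
  refine Nat.card_eq_of_bijective
    (fun f => ⟨(Γ.forestOf f.1, {v | f.1 v = none}), ⟨f.2.1.isSpanningForest, f.2.1.isRootSet⟩,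
      f.2.2⟩) ⟨fun f g hfg => ?_, fun P => ?_⟩
  · have h := Prod.ext_iff.1 (Subtype.ext_iff.1 hfg)
    exact Subtype.ext (f.2.1.eq_of_forestOf_eq g.2.1 h.1 (Set.ext_iff.1 h.2))
  · obtain ⟨f, hf, hF, hR⟩ := P.2.1.1.exists_parentFunction P.2.1.2
    exact ⟨⟨f, hf, hR ▸ P.2.2⟩, Subtype.ext (Prod.ext hF hR)⟩

end Pointers

/-! ### The matrix-tree theorem -/

section Laplacian

variable {V : Type u} {D : Type v}

open scoped Classical in
/-- The contribution to the row at `v` of the Laplacian of an edge going out of `v`, or, for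
`none`, of the additional `1` on the diagonal at the vertices where a root is allowed. -/
noncomputable def laplacianTerm (Γ : SerreGraph V D) (v : V) (o : Option D) : V → ℤ :=
  Pi.single v 1 - o.elim 0 fun e => Pi.single (Γ.t e) 1

open scoped Classical in
/-- The possible values at `v` of the parent function of a forest with roots in `S`. -/
noncomputable def parentChoices [Fintype D] (Γ : SerreGraph V D) (S : Set V) (v : V) :
    Finset (Option D) :=
  Finset.univ.filter fun o => o.elim (v ∈ S) fun e => Γ.s e = v

/-- The Laplacian of the graph plus the diagonal matrix of the indicator function of `S`. -/
noncomputable def laplacian [Fintype D] (Γ : SerreGraph V D) (S : Set V) : Matrix V V ℤ :=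
  Matrix.of fun v => ∑ o ∈ Γ.parentChoices S v, Γ.laplacianTerm v o

open scoped Classical in
theorem laplacian_apply [Fintype D] (Γ : SerreGraph V D) (S : Set V) (v : V) :
    Γ.laplacian S v = (if v ∈ S then Pi.single v 1 else 0) +
      ∑ e with Γ.s e = v, (Pi.single v 1 - Pi.single (Γ.t e) 1) := by
  change ∑ o ∈ Γ.parentChoices S v, Γ.laplacianTerm v o = _
  rw [parentChoices, Finset.sum_filter, Fintype.sum_option, Finset.sum_filter]
  simp only [Option.elim_none, Option.elim_some, laplacianTerm, sub_zero]
  congr!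

open scoped Classical in
/-- In an order of the vertices compatible with the rank the matrix is triangular, with `1` on the
diagonal. -/
theorem IsParentFunction.det_laplacianTerm [Fintype V] {Γ : SerreGraph V D} {f : V → Option D}
    (hf : Γ.IsParentFunction f) :
    (Matrix.of fun v => Γ.laplacianTerm v (f v)).det = 1 := by
  have hentry : ∀ v w, hf.rank v ≤ hf.rank w →
      Γ.laplacianTerm v (f v) w = (1 : Matrix V V ℤ) v w := by
    intro v w hvw
    cases hv : f v with
    | none => simp [laplacianTerm, Matrix.one_apply, Pi.single_apply, eq_comm]
    | some e =>
      have hne : w ≠ Γ.t e := by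
        rintro rfl
        exact ((hf.rank_lt hv).trans_le hvw).false
      simp [laplacianTerm, Matrix.one_apply, Pi.single_apply, eq_comm (a := v), hne]
  have htri : (Matrix.of fun v => Γ.laplacianTerm v (f v)).BlockTriangular
      (OrderDual.toDual ∘ hf.rank) := by
    intro v w hvw
    have hlt : hf.rank v < hf.rank w := hvw
    rw [Matrix.of_apply, hentry v w hlt.le, Matrix.one_apply_ne]
    rintro rfl
    exact hlt.false
  rw [htri.det]
  refine Finset.prod_eq_one fun a _ => ?_
  rw [show Matrix.toSquareBlock _ _ a = 1 from ?_, Matrix.det_one]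
  ext ⟨v, hv⟩ ⟨w, hw⟩
  have hvw : hf.rank v = hf.rank w := OrderDual.toDual.injective (hv.trans hw.symm)
  rw [Matrix.toSquareBlock_def, Matrix.of_apply, Matrix.of_apply, hentry v w hvw.le]
  simp [Matrix.one_apply]

open scoped Classical in
/-- If following `f` goes round a cycle, the indicator function of the set of the vertices from
which this happens is in the kernel. -/
theorem det_laplacianTerm_eq_zero [Fintype V] {Γ : SerreGraph V D} {f : V → Option D}
    (hf : ¬ WellFounded (Γ.Next f)) :
    (Matrix.of fun v => Γ.laplacianTerm v (f v)).det = 0 := by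
  obtain ⟨v₀, hv₀⟩ : ∃ v, ¬ Acc (Γ.Next f) v := by
    by_contra! h
    exact hf ⟨h⟩
  refine Matrix.exists_mulVec_eq_zero_iff.1
    ⟨fun v => if Acc (Γ.Next f) v then 0 else 1, fun h => ?_, ?_⟩
  · simpa [hv₀] using congrFun h v₀
  · ext v
    change Γ.laplacianTerm v (f v) ⬝ᵥ _ = 0
    cases hv : f v with
    | none =>
      have hacc : Acc (Γ.Next f) v := ⟨v, fun w ⟨e, he, _⟩ => by rw [hv] at he; cases he⟩
      simp [laplacianTerm, hacc]
    | some e =>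
      have hacc : Acc (Γ.Next f) v ↔ Acc (Γ.Next f) (Γ.t e) := by
        refine ⟨fun h => h.inv ⟨e, hv, rfl⟩, fun h => ⟨v, ?_⟩⟩
        rintro w ⟨e', he', rfl⟩
        obtain rfl : e = e' := Option.some_inj.1 (hv.symm.trans he')
        exact h
      simp [laplacianTerm, sub_dotProduct, hacc]

open scoped Classical in
/-- The matrix-tree theorem for forests with roots in `S`. -/
theorem det_laplacian [Fintype V] [Fintype D] (Γ : SerreGraph V D) (S : Set V) :
    (Γ.laplacian S).det = Γ.numForestsRootedIn S := by
  have hexp : (Γ.laplacian S).det = ∑ f ∈ Fintype.piFinset (Γ.parentChoices S),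
      (Matrix.of fun v => Γ.laplacianTerm v (f v)).det :=
    Matrix.detRowAlternating.toMultilinearMap.map_sum_finset
      (fun v o => Γ.laplacianTerm v o) (Γ.parentChoices S)
  have hmem : ∀ f : V → Option D, Γ.IsParentFunction f ∧ {v | f v = none} ⊆ S ↔
      f ∈ Fintype.piFinset (Γ.parentChoices S) ∧ WellFounded (Γ.Next f) := by
    intro f
    have hiff : ∀ v, f v ∈ Γ.parentChoices S v ↔
        (∀ e, f v = some e → Γ.s e = v) ∧ (f v = none → v ∈ S) := by
      intro v
      cases hv : f v <;> simp [parentChoices]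
    rw [Fintype.mem_piFinset]
    simp only [hiff]
    exact ⟨fun h => ⟨fun v => ⟨h.1.source v, fun hv => h.2 hv⟩, h.1.wf⟩,
      fun h => ⟨⟨fun v => (h.1 v).1, h.2⟩, fun v hv => (h.1 v).2 hv⟩⟩
  have hterm : ∀ f ∈ Fintype.piFinset (Γ.parentChoices S),
      (Matrix.of fun v => Γ.laplacianTerm v (f v)).det =
        if WellFounded (Γ.Next f) then 1 else 0 := by
    intro f hf
    split_ifs with hwf
    · refine IsParentFunction.det_laplacianTerm ⟨fun v e he => ?_, hwf⟩
      have h := Fintype.mem_piFinset.1 hf v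
      simpa [parentChoices, he] using h
    · exact det_laplacianTerm_eq_zero hwf
  rw [hexp, Finset.sum_congr rfl hterm, Finset.sum_boole, numForestsRootedIn_eq_card]
  congr 1
  rw [Nat.card_eq_fintype_card, Fintype.card_subtype]
  congr 1
  ext f
  simp [hmem]

end Laplacian

/-! ### Cokernels of integral matrices -/

/-- The index in `ℤⁿ` of the lattice spanned by the rows of a square matrix. The index of a
subgroup of infinite index is `0`, so that no condition on the determinant is needed. -/
theorem index_range_vecMulLinear {n : Type*} [Fintype n] [DecidableEq n] (M : Matrix n n ℤ) :
    M.vecMulLinear.range.toAddSubgroup.index = M.det.natAbs := by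
  by_cases hM : M.det = 0
  · obtain ⟨x, hx, hMx⟩ := Matrix.exists_mulVec_eq_zero_iff.2 hM
    -- the row lattice lies in the orthogonal complement of `x`, which has infinite index
    let φ : (n → ℤ) →+ ℤ :=
      { toFun := fun y => y ⬝ᵥ x
        map_zero' := zero_dotProduct x
        map_add' := fun a b => add_dotProduct a b x }
    have hle : M.vecMulLinear.range.toAddSubgroup ≤ φ.ker := by
      rintro _ ⟨y, rfl⟩
      change Matrix.vecMul y M ⬝ᵥ x = 0
      rw [← Matrix.dotProduct_mulVec, hMx, dotProduct_zero]
    have hker : φ.ker.index = 0 := by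
      have hxx : x ⬝ᵥ x ≠ 0 := fun h => hx (dotProduct_self_eq_zero.1 h)
      have hinf : Infinite φ.range :=
        Set.infinite_coe_iff.2 <| Set.infinite_of_injective_forall_mem
          (f := fun k : ℤ => k * (x ⬝ᵥ x)) (mul_left_injective₀ hxx)
          fun k => ⟨k • x, smul_dotProduct k x x⟩
      rw [AddSubgroup.index_ker]
      exact Nat.card_eq_zero_of_infinite
    rw [hM, Int.natAbs_zero]
    exact Nat.eq_zero_of_zero_dvd (hker ▸ AddSubgroup.index_dvd_of_le hle)
  · have hinj : Function.Injective M.vecMulLinear := by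
      rw [injective_iff_map_eq_zero]
      intro y hy
      by_contra hne
      exact hM (Matrix.exists_vecMul_eq_zero_iff.1 ⟨y, hne, hy⟩)
    have h := Submodule.natAbs_det_equiv _ (LinearEquiv.ofInjective M.vecMulLinear hinj)
    have hdet : LinearMap.det M.vecMulLinear = M.det := by
      rw [← M.det_transpose, ← LinearMap.det_toLin']
      congr 1
      ext
      simp
    rw [← hdet]
    exact h.symm

/-- If a surjective map `ℤᵐ → ℤⁿ` carries the rows of `M'` into the lattice spanned by the rows of
`M`, then it induces a surjection between the cokernels, whose orders are the determinants. -/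
theorem natAbs_det_dvd_natAbs_det {m n : Type*} [Fintype m] [DecidableEq m] [Fintype n]
    [DecidableEq n] {M' : Matrix m m ℤ} {M : Matrix n n ℤ} (P : (m → ℤ) →ₗ[ℤ] n → ℤ)
    (hP : Function.Surjective P) (hrow : ∀ i, P (M' i) ∈ M.vecMulLinear.range) :
    M.det.natAbs ∣ M'.det.natAbs := by
  rw [← index_range_vecMulLinear, ← index_range_vecMulLinear,
    ← AddSubgroup.index_comap_of_surjective (f := P.toAddMonoidHom) _ hP]
  refine AddSubgroup.index_dvd_of_le ?_
  rintro _ ⟨y, rfl⟩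
  change P (Matrix.vecMul y M') ∈ M.vecMulLinear.range
  rw [Matrix.vecMul_eq_sum, map_sum]
  refine Submodule.sum_mem _ fun i _ => ?_
  rw [map_smul]
  exact Submodule.smul_mem _ _ (hrow i)

/-! ### Coverings -/

section Coverings

variable {V : Type u} {D : Type v} {V' : Type u'} {D' : Type v'}

open scoped Classical in
theorem sum_laplacian_empty [Fintype V] [Fintype D] (Γ : SerreGraph V D) :
    ∑ v, Γ.laplacian ∅ v = 0 := by
  have hfib : ∑ v, Γ.laplacian ∅ v =
      ∑ e, (Pi.single (Γ.s e) 1 - Pi.single (Γ.t e) 1 : V → ℤ) := by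
    rw [← Finset.sum_fiberwise Finset.univ Γ.s]
    refine Finset.sum_congr rfl fun v _ => ?_
    rw [laplacian_apply, if_neg (Set.notMem_empty v), zero_add]
    refine Finset.sum_congr rfl fun e he => ?_
    rw [(Finset.mem_filter.1 he).2]
  have hinv : ∑ e, (Pi.single (Γ.t e) 1 : V → ℤ) = ∑ e, Pi.single (Γ.s e) 1 := by
    rw [← Function.Bijective.sum_comp (Function.Involutive.bijective (f := Γ.inv) Γ.inv_inv)]
    exact Finset.sum_congr rfl fun e _ => by rw [Γ.t_inv]
  rw [hfib, Finset.sum_sub_distrib, hinv, sub_self]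

open scoped Classical in
theorem laplacian_eq_add [Fintype D] (Γ : SerreGraph V D) (S : Set V) (v : V) :
    Γ.laplacian S v = (if v ∈ S then Pi.single v 1 else 0) + Γ.laplacian ∅ v := by
  rw [laplacian_apply, laplacian_apply, if_neg (Set.notMem_empty v), zero_add]

theorem laplacian_mem_range [Fintype V] [Fintype D] (Γ : SerreGraph V D) (S : Set V) (v : V) :
    Γ.laplacian S v ∈ (Γ.laplacian S).vecMulLinear.range := by
  classical
  exact ⟨Pi.single v 1, Matrix.single_one_vecMul v _⟩

open scoped Classical in
theorem single_mem_range_laplacian [Fintype V] [Fintype D] (Γ : SerreGraph V D) (v : V) :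
    Pi.single v 1 ∈ (Γ.laplacian {v}).vecMulLinear.range := by
  have hsum : ∑ w, Γ.laplacian {v} w = Pi.single v 1 := by
    rw [Finset.sum_congr rfl fun w _ => Γ.laplacian_eq_add {v} w]
    refine Finset.sum_add_distrib.trans ?_
    rw [sum_laplacian_empty, add_zero]
    simp
  rw [← hsum]
  exact Submodule.sum_mem _ fun w _ => Γ.laplacian_mem_range {v} w

namespace Hom

variable {Γ' : SerreGraph V' D'} {Γ : SerreGraph V D}

open scoped Classical in
/-- The push-forward of integral functions on the vertices: it sums over the fibres of `p`. -/
noncomputable def pushforward [Fintype V'] (p : Γ'.Hom Γ) : (V' → ℤ) →ₗ[ℤ] V → ℤ :=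
  Fintype.linearCombination ℤ fun v => Pi.single (p.onVerts v) 1

open scoped Classical in
theorem pushforward_single [Fintype V'] (p : Γ'.Hom Γ) (v : V') :
    p.pushforward (Pi.single v 1) = Pi.single (p.onVerts v) 1 := by
  simp [pushforward, Fintype.linearCombination_apply_single]

theorem IsCovering.pushforward_surjective [Fintype V'] [Finite V] {p : Γ'.Hom Γ}
    (hp : p.IsCovering) : Function.Surjective p.pushforward := by
  classical
  have := Fintype.ofFinite V
  intro y
  refine ⟨∑ v, y v • Pi.single (Function.surjInv hp.surjective v) 1, ?_⟩
  simp only [map_sum, map_smul, pushforward_single, Function.surjInv_eq]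
  exact (pi_eq_sum_univ' y).symm

/-- Push-forward commutes with the Laplacians, since a covering maps the edges going out of a
vertex bijectively. -/
theorem IsCovering.pushforward_laplacian [Fintype V'] [Fintype D'] [Fintype D] {p : Γ'.Hom Γ}
    (hp : p.IsCovering) (v : V') :
    p.pushforward (Γ'.laplacian ∅ v) = Γ.laplacian ∅ (p.onVerts v) := by
  classical
  rw [laplacian_apply, laplacian_apply, if_neg (Set.notMem_empty _), if_neg (Set.notMem_empty _),
    zero_add, zero_add, map_sum]
  have hb := hp.bijOn_source v
  refine Finset.sum_nbij p.onEdges (fun e he => ?_) ?_ ?_ fun e _ => ?_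
  · simpa using hb.mapsTo (Finset.mem_filter.1 he).2
  · simpa using hb.injOn
  · simpa using hb.surjOn
  · rw [map_sub, pushforward_single, pushforward_single, p.t_comm]

theorem IsCovering.numSpanningTrees_dvd [Finite V] [Finite D] [Finite V'] [Finite D']
    {p : Γ'.Hom Γ} (hp : p.IsCovering) : Γ.numSpanningTrees ∣ Γ'.numSpanningTrees := by
  classical
  have := Fintype.ofFinite V
  have := Fintype.ofFinite D
  have := Fintype.ofFinite V'
  have := Fintype.ofFinite D'
  rcases isEmpty_or_nonempty V' with hV' | ⟨⟨v⟩⟩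
  · -- the empty graph has no spanning tree
    have : IsEmpty {T : Γ'.Subgraph // T.IsSpanningTree} :=
      ⟨fun T => T.2.nonempty.elim fun v _ => hV'.elim v⟩
    rw [show Γ'.numSpanningTrees = 0 from Nat.card_of_isEmpty]
    exact dvd_zero _
  have hdvd := natAbs_det_dvd_natAbs_det (M' := Γ'.laplacian {v})
    (M := Γ.laplacian {p.onVerts v}) p.pushforward hp.pushforward_surjective fun w => ?_
  · simpa [det_laplacian, numForestsRootedIn_singleton] using hdvd
  · have hsingle := Γ.single_mem_range_laplacian (p.onVerts v)
    have hrow := Γ.laplacian_mem_range {p.onVerts v} (p.onVerts w)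
    rw [laplacian_eq_add] at hrow
    rw [laplacian_eq_add, map_add, hp.pushforward_laplacian]
    refine Submodule.add_mem _ ?_ ((Submodule.add_mem_iff_right _ ?_).1 hrow)
    · split_ifs with h
      · rwa [Set.mem_singleton_iff.1 h, pushforward_single]
      · rw [map_zero]
        exact Submodule.zero_mem _
    · split_ifs with h
      · rwa [Set.mem_singleton_iff.1 h]
      · exact Submodule.zero_mem _

theorem IsCovering.numRootedSpanningForests_dvd [Finite V] [Finite D] [Finite V'] [Finite D']
    {p : Γ'.Hom Γ} (hp : p.IsCovering) :
    Γ.numRootedSpanningForests ∣ Γ'.numRootedSpanningForests := by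
  classical
  have := Fintype.ofFinite V
  have := Fintype.ofFinite D
  have := Fintype.ofFinite V'
  have := Fintype.ofFinite D'
  have hdvd := natAbs_det_dvd_natAbs_det (M' := Γ'.laplacian Set.univ)
    (M := Γ.laplacian Set.univ) p.pushforward hp.pushforward_surjective fun w => ?_
  · simpa [det_laplacian, numForestsRootedIn_univ] using hdvd
  · have hrow := Γ.laplacian_mem_range Set.univ (p.onVerts w)
    rw [laplacian_eq_add, if_pos (Set.mem_univ _)] at hrow
    rwa [laplacian_eq_add, if_pos (Set.mem_univ _), map_add, pushforward_single,
      hp.pushforward_laplacian]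

end Hom

end Coverings

end SerreGraph

theorem mainTheorem6 {V : Type u} {D : Type v} {V' : Type u'} {D' : Type v'}
    [Finite V] [Finite D] [Finite V'] [Finite D']
    (Γ : SerreGraph V D) (hΓ : Γ.Connected)
    (Γ' : SerreGraph V' D') (p : Γ'.Hom Γ) (hp : p.IsCovering) :
    Γ.numSpanningTrees ∣ Γ'.numSpanningTrees ∧
      Γ.numRootedSpanningForests ∣ Γ'.numRootedSpanningForests :=
  ⟨hp.numSpanningTrees_dvd, hp.numRootedSpanningForests_dvd⟩
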